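/- Let $\Gamma=(V,E)$ be a finite simple graph, let $(G_v)_{v\in V}$ be groups, and let $G_V$ be their graph product with respect to $\Gamma$, i.e. the quotient of the free product of the $G_v$ by the normal closure of all commutators $[g,h]$ with $g\in G_v$, $h\in G_w$, $\{v,w\}\in E$. For each $v\in V$ let $X_v$ be an inverse-closed generating set of $G_v$. For $S\subseteq V$ let $G_S\le G_V$ be the subgroup generated by the images of the $G_v$, $v\in S$, and let $X_S=\bigcup_{v\in S}X_v\subseteq G_V$. Let $V'\subseteq V$, and let $\ll$ be a strict total order on $V$ with $a\ll b$ for all $a\in V'$ and $b\in V\setminus V'$. Let $<$ be a strict total order on $X_V$ that is a well-order (which is automatic if every $X_v$ is finite) and is compatible with $\ll$: there are strict total orders $<_v$ on the sets $X_v$ such that, for $a\in X_v$ and $b\in X_w$, we have $a<b$ if and only if $v\ll w$, or $v=w$ and $a<_v b$. (This forces the identity to lie in at most one of the sets $X_v$.) Order the set $X_V^*$ of words by the shortlex order induced by $<$ (shorter words first, words of equal length lexicographically). Let $\mathrm{SL}(G_V,X_V)$ be the set of shortlex normal forms, i.e. of the shortlex least words over $X_V$ representing the elements of $G_V$. Then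 the set of words $$\widehat U:=\{\lambda\}\cup\bigl(\mathrm{SL}(G_V,X_V)\cap X_{V\setminus V'}X_V^*\bigr),$$ consisting of the empty word $\lambda$ and the shortlex normal forms whose first letter is in $X_{V\setminus V'}$, is a set of unique representatives of an admissible right transversal $U$ for $G_{V'}$ in $G_V$ with respect to $(X_V,X_{V'})$. That is, there is a set $U\subseteq G_V$ such that the natural projection $X_V^*\to G_V$ restricts to a bijection $\widehat U\to U$, and: $X_V$ and $X_{V'}$ are inverse-closed generating sets of $G_V$ and $G_{V'}$ with $X_{V'}\subseteq X_V$; every $g\in G_V$ is $g=hu$ for exactly one pair $(h,u)\in G_{V'}\times U$; $1\in U$; and $|hu|_{X_V}=|h|_{X_{V'}}+|u|_{X_V}$ for all $h\in G_{V'}$ and $u\in U$, where $|\cdot|_X$ denotes the length of a shortest representing word over $X$. -/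

import Mathlib

/-! ### Words, word length and shortlex normal forms in a group with a generating set -/

section Words

variable {G : Type*} [Group G]

/-- `X` is an inverse-closed generating set of the subgroup `H` of `G`
(of `G` itself when `H = ⊤`). -/
structure IsInvClosedGenSet (X : Set G) (H : Subgroup G) : Prop where
  inv_mem : ∀ x ∈ X, x⁻¹ ∈ X
  closure_eq : Subgroup.closure X = H

/-- The natural projection `π : X^* → G` from words over `X` to the group. -/
def wordEval {X : Set G} (w : List X) : G :=
  (w.map (fun x : X => (x : G))).prod

/-- The length `|g|_X` of `g`: the length of a shortest word over `X` representing `g`.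
(It is meaningful when some word over `X` represents `g`.) -/
noncomputable def eltLength (X : Set G) (g : G) : ℕ :=
  sInf {n : ℕ | ∃ w : List X, wordEval w = g ∧ w.length = n}

/-- `w` is the shortlex normal form of `g` over `X`, for the shortlex order induced by the strict
order `r` on the alphabet `X`: it represents `g`, and it is shortlex-below every word
representing `g`. -/
def IsShortlexNormalForm {X : Set G} (r : X → X → Prop) (g : G) (w : List X) : Prop :=
  wordEval w = g ∧ ∀ w' : List X, wordEval w' = g → w = w' ∨ List.Shortlex r w w'

/-- The language of shortlex normal forms of the elements of `G` over `X`. -/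
def shortlexLanguage {X : Set G} (r : X → X → Prop) : Set (List X) :=
  {w | ∃ g : G, IsShortlexNormalForm r g w}

/-- `U` is an admissible right transversal of the subgroup `H` in `G` with respect to `(X, Y)`,
where `X`, `Y` are inverse-closed generating sets of `G`, `H` with `Y ⊆ X`: every `g : G` is
`h * u` for exactly one pair `(h, u)` in `H × U`, the representative of `H` is the identity,
and `|h * u|_X = |h|_Y + |u|_X`. -/
structure IsAdmissibleRightTransversal (H : Subgroup G) (X Y U : Set G) : Prop where
  gen_top : IsInvClosedGenSet X ⊤
  gen_sub : IsInvClosedGenSet Y H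
  subset : Y ⊆ X
  transversal : Subgroup.IsComplement (H : Set G) U
  one_mem : (1 : G) ∈ U
  length_mul : ∀ h ∈ H, ∀ u ∈ U, eltLength X (h * u) = eltLength Y h + eltLength X u

end Words

/-! ### Graph products -/

section GraphProducts

open scoped commutatorElement

variable {V : Type*} (Γ : SimpleGraph V) (G : V → Type*) [∀ v, Group (G v)]

/-- The relators `[g, h]`, for `g ∈ G v` and `h ∈ G w` with `{v, w}` an edge, in the free product
of the vertex groups. -/
def graphProductRels : Set (Monoid.CoprodI G) :=
  {x | ∃ (v w : V) (_ : Γ.Adj v w) (g : G v) (h : G w),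
    x = ⁅(Monoid.CoprodI.of g : Monoid.CoprodI G), (Monoid.CoprodI.of h : Monoid.CoprodI G)⁆}

/-- The graph product of the groups `G v` with respect to `Γ`. -/
abbrev GraphProduct : Type _ :=
  Monoid.CoprodI G ⧸ Subgroup.normalClosure (graphProductRels Γ G)

/-- The natural map from a vertex group to the graph product. -/
def GraphProduct.of (v : V) : G v →* GraphProduct Γ G :=
  (QuotientGroup.mk' (Subgroup.normalClosure (graphProductRels Γ G))).comp Monoid.CoprodI.of

/-- The subgraph product `G_S = ⟨G_v | v ∈ S⟩`. -/
def subgraphProduct (S : Set V) : Subgroup (GraphProduct Γ G) :=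
  Subgroup.closure (⋃ v ∈ S, Set.range (GraphProduct.of Γ G v))

variable {G}

/-- The set `X_S = ⋃_{v ∈ S} X_v` of elements of the graph product. -/
def graphProductGens (X : ∀ v, Set (G v)) (S : Set V) : Set (GraphProduct Γ G) :=
  ⋃ v ∈ S, GraphProduct.of Γ G v '' X v

/-- The letter of the alphabet `X_V` given by an element of `X_v`. -/
def vertexLetter (X : ∀ v, Set (G v)) (v : V) (a : X v) :
    graphProductGens Γ X Set.univ :=
  ⟨GraphProduct.of Γ G v a,
    Set.mem_biUnion (Set.mem_univ v) (Set.mem_image_of_mem _ a.2)⟩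

/-- The order `r` on `X_V` is compatible with the strict order `ll` on `V`: there are strict total
orders `s v` on the sets `X_v` such that, for letters `a ∈ X_v` and `b ∈ X_w`, `r a b` holds iff
`ll v w`, or `v = w` and `s v a b`. -/
def IsCompatibleOrder (X : ∀ v, Set (G v)) (ll : V → V → Prop)
    (r : graphProductGens Γ X Set.univ → graphProductGens Γ X Set.univ → Prop) : Prop :=
  ∃ s : ∀ v, X v → X v → Prop, (∀ v, IsStrictTotalOrder (X v) (s v)) ∧
    ∀ (v w : V) (a : X v) (b : X w),
      r (vertexLetter Γ X v a) (vertexLetter Γ X w b) ↔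
        Sigma.Lex ll s (⟨v, a⟩ : Σ v, X v) ⟨w, b⟩

/-- The language consisting of the empty word and of the shortlex normal forms over `X_V` whose
first letter belongs to `X_{V ∖ S}`. -/
def transversalLanguage (X : ∀ v, Set (G v)) (S : Set V)
    (r : graphProductGens Γ X Set.univ → graphProductGens Γ X Set.univ → Prop) :
    Set (List (graphProductGens Γ X Set.univ)) :=
  {[]} ∪ (shortlexLanguage r ∩
    {w | ∃ (a : graphProductGens Γ X Set.univ) (t : List (graphProductGens Γ X Set.univ)),
      (a : GraphProduct Γ G) ∈ graphProductGens Γ X Sᶜ ∧ w = a :: t})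

end GraphProducts

/-! The theorem rests on a sharpened transversal (`IsCommutingTransversal`): a set K of
representatives of the left cosets of G_S in G_T such that for k ∈ K and x in a vertex group G_v, v
∈ T, either xk ∈ K, or v ∈ S and x commutes with k. For S = V', T = V, let U consist of the inverses
of K. A letter multiplied onto u ∈ U from the right either keeps it in U or lies in X_{V'} and
slides past u. Hence any word for hu splits, with no additional letters, into a word for h and a
word for u, and lengths add (`eltLength_mul_of_mem_or`).

Such K exist by induction on |T| (`exists_isCommutingTransversal`), removing some v ∈ T ∖ S. With A
= G_{T∖{v}} and L ≤ A generated by the groups of the neighbours of v, the group G_T is the amalgam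
of A and L × G_v over L. So the cosets of A should have normal forms k₁x₁⋯kₙxₙ with kᵢ representing
cosets of L in A and xᵢ ∈ G_v. Their uniqueness is van der Waerden's argument: the graph product
acts on formal lists, and each such product sends the empty list to its own list
(`IsCommutingTransversal.exists_insert`).

Additivity of lengths then identifies the language (`IsAdmissibleRightTransversal.bijOn_wordEval`):
a nontrivial factor h could be moved to the front of a geodesic, where it would give a smaller first
letter. -/

/-! ### Alternating lists of coset representatives and elements of a second group -/

section AlternatingLists

variable {A B : Type*} [Group A] [Group B]

/-- `rep` chooses a representative in each left coset of `L`, namely `1` in `L` itself. -/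
structure IsCosetRep (L : Subgroup A) (rep : A → A) : Prop where
  inv_mul_mem : ∀ a, (rep a)⁻¹ * a ∈ L
  mul_right : ∀ a, ∀ l ∈ L, rep (a * l) = rep a
  one : rep 1 = 1

theorem IsCosetRep.rep_mul_rep {L : Subgroup A} {rep : A → A} (h : IsCosetRep L rep) (a b : A) :
    rep (a * rep b) = rep (a * b) := by
  have := h.mul_right (a * rep b) _ (h.inv_mul_mem b)
  rw [← this]
  congr 1
  group

theorem IsCosetRep.rep_rep {L : Subgroup A} {rep : A → A} (h : IsCosetRep L rep) (a : A) :
    rep (rep a) = rep a := by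
  simpa using h.rep_mul_rep 1 a

theorem IsCosetRep.rep_of_mem {L : Subgroup A} {rep : A → A} (h : IsCosetRep L rep) {l : A}
    (hl : l ∈ L) : rep l = 1 := by
  simpa [h.one] using h.mul_right 1 l hl

theorem IsCosetRep.mem_of_rep {L : Subgroup A} {rep : A → A} (h : IsCosetRep L rep) {a : A}
    (ha : rep a = 1) : a ∈ L := by
  simpa [ha] using h.inv_mul_mem a

/-- The alternating lists `(k₁, x₁), …, (kₙ, xₙ)`: the `kᵢ` are representatives, the `xᵢ` are
nontrivial and so are the `kᵢ` for `i > 1`. -/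
def IsAlternating (rep : A → A) : List (A × B) → Prop
  | [] => True
  | p :: t => rep p.1 = p.1 ∧ p.2 ≠ 1 ∧ IsAlternating rep t ∧ ∀ q ∈ t.head?, q.1 ≠ 1

/-- Left multiplication by an element of `A`, which is carried to the right through the
representatives. -/
def carryMul (rep : A → A) : A → List (A × B) → List (A × B)
  | _, [] => []
  | a, p :: t => (rep (a * p.1), p.2) :: carryMul rep ((rep (a * p.1))⁻¹ * (a * p.1)) t

open Classical in
/-- Left multiplication by an element of `B`. -/
noncomputable def consMul (b : B) : List (A × B) → List (A × B)
  | [] => if b = 1 then [] else [(1, b)]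
  | p :: t =>
    if p.1 = 1 then (if b * p.2 = 1 then t else (1, b * p.2) :: t)
    else if b = 1 then p :: t else (1, b) :: p :: t

variable {L : Subgroup A} {rep : A → A}

theorem carryMul_one (w : List (A × B)) (hw : IsAlternating rep w) :
    carryMul rep 1 w = w := by
  induction w with
  | nil => rfl
  | cons p t ih =>
    obtain ⟨h1, -, h3, -⟩ := hw
    simp [carryMul, h1, ih h3]

theorem carryMul_mul (h : IsCosetRep L rep) (a b : A) (w : List (A × B)) :
    carryMul rep (a * b) w = carryMul rep a (carryMul rep b w) := by
  induction w generalizing a b with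
  | nil => rfl
  | cons p t ih =>
    have e : rep (a * rep (b * p.1)) = rep (a * b * p.1) := by
      rw [h.rep_mul_rep, mul_assoc]
    simp only [carryMul, e, ← ih]
    congr 2
    group

/-- An element of `L` times a first entry lies in `L` only if that entry does, and the sole
representative in `L` is 1. -/
theorem carryMul_head (h : IsCosetRep L rep) {l : A} (hl : l ∈ L) (w : List (A × B))
    (hw : IsAlternating rep w) (hh : ∀ q ∈ w.head?, q.1 ≠ 1) :
    ∀ q ∈ (carryMul rep l w).head?, q.1 ≠ 1 := by
  cases w with
  | nil => simp [carryMul]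
  | cons p t =>
    simp only [carryMul, List.head?_cons, Option.mem_some_iff, forall_eq'] at hh ⊢
    intro e
    have := h.mem_of_rep e
    rw [L.mul_mem_cancel_left hl] at this
    exact hh (hw.1 ▸ h.rep_of_mem this)

theorem IsAlternating.carryMul (h : IsCosetRep L rep) {w : List (A × B)}
    (hw : IsAlternating rep w) (a : A) : IsAlternating rep (carryMul rep a w) := by
  induction w generalizing a with
  | nil => exact hw
  | cons p t ih =>
    obtain ⟨-, h2, h3, h4⟩ := hw
    exact ⟨h.rep_rep _, h2, ih h3 _, carryMul_head h (h.inv_mul_mem _) t h3 h4⟩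

theorem consMul_of_head {b : B} (hb : b ≠ 1) {w : List (A × B)}
    (hh : ∀ q ∈ w.head?, q.1 ≠ 1) : consMul b w = (1, b) :: w := by
  cases w with
  | nil => simp [consMul, hb]
  | cons p t =>
    have : p.1 ≠ 1 := by simpa using hh
    simp [consMul, hb, this]

open Classical in
theorem consMul_one_cons (b c : B) (t : List (A × B)) :
    consMul b ((1, c) :: t) = if b * c = 1 then t else (1, b * c) :: t := by
  simp [consMul]

theorem consMul_one {w : List (A × B)} (hw : IsAlternating rep w) : consMul 1 w = w := by
  cases w with
  | nil => simp [consMul]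
  | cons p t =>
    obtain ⟨k, x⟩ := p
    have := hw.2.1
    by_cases hk : k = 1
    · subst hk; simp_all [consMul]
    · simp [consMul, hk]

/-- An alternating list either starts with a trivial representative or is ready for a new
first entry. -/
theorem IsAlternating.cases_head {w : List (A × B)} (hw : IsAlternating rep w) :
    (∀ q ∈ w.head?, q.1 ≠ 1) ∨ ∃ c t, w = (1, c) :: t ∧ c ≠ 1 ∧ IsAlternating rep t ∧
      ∀ q ∈ t.head?, q.1 ≠ 1 := by
  cases w with
  | nil => simp
  | cons p t =>
    obtain ⟨k, x⟩ := p
    by_cases hk : k = 1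
    · subst hk
      exact Or.inr ⟨x, t, rfl, hw.2⟩
    · simp [hk]

theorem IsAlternating.consMul (h : IsCosetRep L rep) {w : List (A × B)}
    (hw : IsAlternating rep w) (b : B) : IsAlternating rep (consMul b w) := by
  rcases hw.cases_head with hh | ⟨c, t, rfl, hc, ht, hh⟩
  · by_cases hb : b = 1
    · rwa [hb, consMul_one hw]
    · rw [consMul_of_head hb hh]
      exact ⟨h.one, hb, hw, hh⟩
  · rw [consMul_one_cons]
    split_ifs with hbc
    · exact ht
    · exact ⟨h.one, hbc, ht, hh⟩

theorem consMul_mul {w : List (A × B)} (hw : IsAlternating rep w) (a b : B) :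
    consMul (a * b) w = consMul a (consMul b w) := by
  have key : ∀ (a b : B) (t : List (A × B)), IsAlternating rep t → (∀ q ∈ t.head?, q.1 ≠ 1) →
      consMul (a * b) t = consMul a (consMul b t) := by
    intro a b t ht hh
    by_cases hb : b = 1
    · rw [hb, mul_one, consMul_one ht]
    · rw [consMul_of_head hb hh, consMul_one_cons]
      split_ifs with hab
      · rw [hab, consMul_one ht]
      · rw [consMul_of_head hab hh]
  rcases hw.cases_head with hh | ⟨c, t, rfl, hc, ht, hh⟩
  · exact key a b w hw hh
  -- A list starting with (1, c) is itself `consMul c t`, so this case is associativity in `B`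
  -- together with `key` for `t`.
  · rw [← consMul_of_head hc hh, ← key _ _ t ht hh, ← key _ _ t ht hh, ← key _ _ t ht hh,
      mul_assoc]

/-- This is the relation of the direct product L × B. Since `rep l = 1`, carrying `l` through an
entry (1, b) leaves the entry unchanged and passes on all of `l`. -/
theorem carryMul_consMul_comm (h : IsCosetRep L rep) {l : A} (hl : l ∈ L) (b : B)
    {w : List (A × B)} (hw : IsAlternating rep w) :
    carryMul rep l (consMul b w) = consMul b (carryMul rep l w) := by
  have key : ∀ (b : B) (t : List (A × B)), IsAlternating rep t → (∀ q ∈ t.head?, q.1 ≠ 1) →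
      carryMul rep l (consMul b t) = consMul b (carryMul rep l t) := by
    intro b t ht hh
    by_cases hb : b = 1
    · rw [hb, consMul_one ht, consMul_one (ht.carryMul h l)]
    · rw [consMul_of_head hb hh, consMul_of_head hb (carryMul_head h hl t ht hh)]
      simp [carryMul, h.rep_of_mem hl]
  rcases hw.cases_head with hh | ⟨c, t, rfl, hc, ht, hh⟩
  · exact key b w hw hh
  · rw [← consMul_of_head hc hh, ← consMul_mul ht, key _ t ht hh, key _ t ht hh,
      consMul_mul (ht.carryMul h l)]

variable (B) in
/-- The action of `A` on alternating lists. -/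
def carryPerm (h : IsCosetRep L rep) : A →* Equiv.Perm {w : List (A × B) // IsAlternating rep w} :=
  letI : MulAction A {w : List (A × B) // IsAlternating rep w} :=
    { smul := fun a w => ⟨carryMul rep a w.1, w.2.carryMul h a⟩
      one_smul := fun w => Subtype.ext (carryMul_one w.1 w.2)
      mul_smul := fun a b w => Subtype.ext (carryMul_mul h a b w.1) }
  MulAction.toPermHom A _

/-- The action of `B` on alternating lists. -/
noncomputable def consPerm (h : IsCosetRep L rep) :
    B →* Equiv.Perm {w : List (A × B) // IsAlternating rep w} :=
  letI : MulAction B {w : List (A × B) // IsAlternating rep w} :=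
    { smul := fun b w => ⟨consMul b w.1, w.2.consMul h b⟩
      one_smul := fun w => Subtype.ext (consMul_one w.2)
      mul_smul := fun a b w => Subtype.ext (consMul_mul w.2 a b) }
  MulAction.toPermHom B _

theorem carryPerm_apply (h : IsCosetRep L rep) (a : A)
    (w : {w : List (A × B) // IsAlternating rep w}) :
    (carryPerm B h a w).1 = carryMul rep a w.1 := rfl

theorem consPerm_apply (h : IsCosetRep L rep) (b : B)
    (w : {w : List (A × B) // IsAlternating rep w}) :
    (consPerm h b w).1 = consMul b w.1 := rfl

theorem commute_carryPerm_consPerm (h : IsCosetRep L rep) {l : A} (hl : l ∈ L) (b : B) :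
    Commute (carryPerm B h l) (consPerm h b) := by
  ext1 w
  exact Subtype.ext (carryMul_consMul_comm h hl b w.2)

end AlternatingLists

/-! ### Transversals of subgraph products -/

section SubgraphTransversals

open scoped commutatorElement

variable {V : Type*} (Γ : SimpleGraph V) (G : V → Type*) [∀ v, Group (G v)]

variable {G} in
theorem GraphProduct.commute_of {v w : V} (hvw : Γ.Adj v w) (g : G v) (h : G w) :
    Commute (GraphProduct.of Γ G v g) (GraphProduct.of Γ G w h) := by
  have : (QuotientGroup.mk' (Subgroup.normalClosure (graphProductRels Γ G)))
      ⁅(Monoid.CoprodI.of g : Monoid.CoprodI G), (Monoid.CoprodI.of h : Monoid.CoprodI G)⁆ = 1 :=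
    (QuotientGroup.eq_one_iff _).2 (Subgroup.subset_normalClosure ⟨v, w, hvw, g, h, rfl⟩)
  rw [map_commutatorElement, commutatorElement_eq_one_iff_commute] at this
  exact this

theorem GraphProduct.exists_lift {H : Type*} [Group H] (f : ∀ v, G v →* H)
    (hf : ∀ v w, Γ.Adj v w → ∀ g h, Commute (f v g) (f w h)) :
    ∃ φ : GraphProduct Γ G →* H, ∀ v g, φ (GraphProduct.of Γ G v g) = f v g := by
  refine ⟨QuotientGroup.lift _ (Monoid.CoprodI.lift f) ?_, fun v g => ?_⟩
  · apply Subgroup.normalClosure_le_normal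
    rintro _ ⟨v, w, hvw, g, h, rfl⟩
    simp only [SetLike.mem_coe, MonoidHom.mem_ker, map_commutatorElement, Monoid.CoprodI.lift_of]
    exact commutatorElement_eq_one_iff_commute.2 (hf v w hvw g h)
  · simp [GraphProduct.of]

variable {Γ G}

theorem of_mem_subgraphProduct {S : Set V} {v : V} (hv : v ∈ S) (g : G v) :
    GraphProduct.of Γ G v g ∈ subgraphProduct Γ G S :=
  Subgroup.subset_closure (Set.mem_biUnion hv ⟨g, rfl⟩)

theorem subgraphProduct_mono {S T : Set V} (h : S ⊆ T) :
    subgraphProduct Γ G S ≤ subgraphProduct Γ G T :=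
  Subgroup.closure_mono (Set.biUnion_subset_biUnion_left h)

theorem subgraphProduct_induction {S : Set V} {p : GraphProduct Γ G → Prop} (one : p 1)
    (mul : ∀ v ∈ S, ∀ g : G v, ∀ a ∈ subgraphProduct Γ G S, p a → p (GraphProduct.of Γ G v g * a))
    {a : GraphProduct Γ G} (ha : a ∈ subgraphProduct Γ G S) : p a := by
  induction ha using Subgroup.closure_induction_left with
  | one => exact one
  | mul_left x hx y hy ih =>
    simp only [Set.mem_iUnion] at hx
    obtain ⟨v, hv, g, rfl⟩ := hx
    exact mul v hv g y hy ih
  | inv_mul_cancel x hx y hy ih =>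
    simp only [Set.mem_iUnion] at hx
    obtain ⟨v, hv, g, rfl⟩ := hx
    rw [← map_inv]
    exact mul v hv g⁻¹ y hy ih

variable (Γ) in
/-- `K` contains exactly one representative of each left coset of `G_S` in `G_T`, and
left multiplication by a vertex group element keeps a representative in `K` or
commutes with it. -/
structure IsCommutingTransversal (S T : Set V) (K : Set (GraphProduct Γ G)) : Prop where
  subset : K ⊆ subgraphProduct Γ G T
  one_mem : 1 ∈ K
  eq_of_eq_mul : ∀ k ∈ K, ∀ k' ∈ K, ∀ l ∈ subgraphProduct Γ G S, k = k' * l → k = k'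
  mul_mem_or : ∀ k ∈ K, ∀ v ∈ T, ∀ x : G v, GraphProduct.of Γ G v x * k ∈ K ∨
    v ∈ S ∧ Commute (GraphProduct.of Γ G v x) k

namespace IsCommutingTransversal

/-- Covering all cosets need not be assumed: a vertex element multiplied onto kl is either absorbed
by k or moves past it into G_S. -/
theorem exists_eq_mul {S T : Set V} {K : Set (GraphProduct Γ G)}
    (hK : IsCommutingTransversal Γ S T K) {g : GraphProduct Γ G}
    (hg : g ∈ subgraphProduct Γ G T) : ∃ k ∈ K, ∃ l ∈ subgraphProduct Γ G S, g = k * l := by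
  refine subgraphProduct_induction (p := fun g => ∃ k ∈ K, ∃ l ∈ subgraphProduct Γ G S, g = k * l)
    ⟨1, hK.one_mem, 1, Subgroup.one_mem _, by simp⟩ ?_ hg
  · intro v hv x a _ ih
    obtain ⟨k, hk, l, hl, rfl⟩ := ih
    rcases hK.mul_mem_or k hk v hv x with h | ⟨hS, h⟩
    · exact ⟨_, h, l, hl, (mul_assoc _ _ _).symm⟩
    · exact ⟨k, hk, _, mul_mem (of_mem_subgraphProduct hS x) hl, by
        rw [← mul_assoc, h.eq, mul_assoc]⟩

theorem refl (S : Set V) : IsCommutingTransversal Γ S S ({1} : Set (GraphProduct Γ G)) where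
  subset := by simp
  one_mem := rfl
  eq_of_eq_mul := by simp
  mul_mem_or := by
    rintro _ rfl v hv x
    exact Or.inr ⟨hv, Commute.one_right _⟩

/-- A vertex element that is not absorbed by m commutes with it and lies in G_T, so it can be tried
against k. -/
theorem trans {S T R : Set V} {K M : Set (GraphProduct Γ G)} (hST : S ⊆ T) (hTR : T ⊆ R)
    (hK : IsCommutingTransversal Γ S T K) (hM : IsCommutingTransversal Γ T R M) :
    IsCommutingTransversal Γ S R (Set.image2 (· * ·) M K) where
  subset := by
    rintro _ ⟨m, hm, k, hk, rfl⟩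
    exact mul_mem (hM.subset hm) (subgraphProduct_mono hTR (hK.subset hk))
  one_mem := ⟨1, hM.one_mem, 1, hK.one_mem, one_mul 1⟩
  eq_of_eq_mul := by
    rintro _ ⟨m, hm, k, hk, rfl⟩ _ ⟨m', hm', k', hk', rfl⟩ l hl h
    have hmm : m = m' := by
      refine hM.eq_of_eq_mul m hm m' hm' (k' * l * k⁻¹) (mul_mem (mul_mem (hK.subset hk')
        (subgraphProduct_mono hST hl)) (inv_mem (hK.subset hk))) ?_
      rw [← mul_assoc, ← mul_assoc, eq_mul_inv_iff_mul_eq]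
      exact h
    subst hmm
    rw [mul_assoc, mul_right_inj] at h
    rw [hK.eq_of_eq_mul k hk k' hk' l hl h]
  mul_mem_or := by
    rintro _ ⟨m, hm, k, hk, rfl⟩ v hv x
    rcases hM.mul_mem_or m hm v hv x with h | ⟨hT, h⟩
    · exact Or.inl ⟨_, h, k, hk, mul_assoc _ _ _⟩
    · rcases hK.mul_mem_or k hk v hT x with h' | ⟨hS, h'⟩
      · refine Or.inl ⟨m, hm, _, h', ?_⟩
        simp only
        rw [← mul_assoc, ← h.eq, mul_assoc]
      · exact Or.inr ⟨hS, h.mul_right h'⟩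

theorem exists_isCosetRep {L S : Set V} {K : Set (GraphProduct Γ G)}
    (hK : IsCommutingTransversal Γ L S K) :
    ∃ rep : subgraphProduct Γ G S → subgraphProduct Γ G S,
      IsCosetRep ((subgraphProduct Γ G L).subgroupOf (subgraphProduct Γ G S)) rep ∧
      ∀ a : subgraphProduct Γ G S, (a : GraphProduct Γ G) ∈ K ↔ rep a = a := by
  have hex : ∀ a : subgraphProduct Γ G S, ∃ k : subgraphProduct Γ G S,
      (k : GraphProduct Γ G) ∈ K ∧ k⁻¹ * a ∈ (subgraphProduct Γ G L).subgroupOf _ := by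
    intro a
    obtain ⟨k, hk, l, hl, h⟩ := hK.exists_eq_mul a.2
    refine ⟨⟨k, hK.subset hk⟩, hk, ?_⟩
    rw [Subgroup.mem_subgroupOf]
    simpa [h] using hl
  choose rep hrep hmem using hex
  have huniq : ∀ a k : subgraphProduct Γ G S, (k : GraphProduct Γ G) ∈ K →
      k⁻¹ * a ∈ (subgraphProduct Γ G L).subgroupOf _ → rep a = k := by
    intro a k hk hka
    have := mul_mem hka (inv_mem (hmem a))
    rw [Subgroup.mem_subgroupOf] at this
    refine Subtype.ext (hK.eq_of_eq_mul _ (hrep a) _ hk _ this ?_)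
    simp [mul_assoc]
  refine ⟨rep, ⟨hmem, fun a l hl => huniq _ _ (hrep a) ?_, huniq _ _ hK.one_mem (by simp)⟩,
    fun a => ⟨fun ha => huniq _ _ ha (by simp), fun ha => ha ▸ hrep a⟩⟩
  rw [← mul_assoc]
  exact mul_mem (hmem a) hl

end IsCommutingTransversal

/-- The element of the graph product spelled by an alternating list. -/
def alternatingProd {H : Type*} [Group H] {A B : Subgroup H} (w : List (A × B)) : H :=
  (w.map fun p => (p.1 * p.2 : H)).prod

section AlternatingProd

variable {H : Type*} [Group H] {A B : Subgroup H}

theorem alternatingProd_nil : alternatingProd ([] : List (A × B)) = 1 := rfl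

theorem alternatingProd_cons (p : A × B) (w : List (A × B)) :
    alternatingProd (p :: w) = p.1 * p.2 * alternatingProd w := by
  simp [alternatingProd]

theorem alternatingProd_consMul {rep : A → A} (b : B) {w : List (A × B)}
    (hw : IsAlternating rep w) : alternatingProd (consMul b w) = b * alternatingProd w := by
  rcases hw.cases_head with hh | ⟨c, t, rfl, -, -, -⟩
  · by_cases hb : b = 1
    · simp [hb, consMul_one hw]
    · simp [consMul_of_head hb hh, alternatingProd_cons]
  · rw [consMul_one_cons]
    split_ifs with hbc
    · rw [alternatingProd_cons, ← mul_assoc, OneMemClass.coe_one, one_mul, ← Subgroup.coe_mul, hbc]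
      simp
    · simp [alternatingProd_cons, mul_assoc]

end AlternatingProd

/-- The factor x travels rightwards until some kᵢ absorbs it. Every kᵢ that does not absorb it
commutes with it and forces u ∈ L, so x also commutes with xᵢ and moves on. If it reaches the end,
it commutes with the whole product. -/
theorem alternatingProd_carryMul {L S : Set V} {v : V} {K : Set (GraphProduct Γ G)}
    (hL : ∀ w ∈ L, Γ.Adj v w) (hK : IsCommutingTransversal Γ L S K)
    {rep : subgraphProduct Γ G S → subgraphProduct Γ G S}
    (hr : IsCosetRep ((subgraphProduct Γ G L).subgroupOf (subgraphProduct Γ G S)) rep)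
    (hrep : ∀ a : subgraphProduct Γ G S, (a : GraphProduct Γ G) ∈ K ↔ rep a = a) {u : V} (hu : u ∈ S) (x : G u)
    {w : List (subgraphProduct Γ G S × (GraphProduct.of Γ G v).range)} (hw : IsAlternating rep w) :
    alternatingProd (carryMul rep ⟨GraphProduct.of Γ G u x, of_mem_subgraphProduct hu x⟩ w) =
        GraphProduct.of Γ G u x * alternatingProd w ∨
      Commute (GraphProduct.of Γ G u x) (alternatingProd w) := by
  induction w with
  | nil => exact Or.inr (Commute.one_right _)
  | cons p t ih =>
    obtain ⟨k, y⟩ := p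
    obtain ⟨hk, -, ht, -⟩ := hw
    rcases hK.mul_mem_or k ((hrep k).2 hk) u hu x with h | ⟨hS, h⟩
    · left
      have e := (hrep (⟨_, of_mem_subgraphProduct hu x⟩ * k)).1 h
      simp only [carryMul, e, inv_mul_cancel, carryMul_one t ht, alternatingProd_cons]
      simp [mul_assoc]
    · have hy : Commute (GraphProduct.of Γ G u x) y := by
        obtain ⟨_, g, rfl⟩ := y
        exact GraphProduct.commute_of Γ (hL u hS).symm x g
      have e : (⟨_, of_mem_subgraphProduct hu x⟩ * k : subgraphProduct Γ G S) =
          k * ⟨_, of_mem_subgraphProduct hu x⟩ := Subtype.ext h.eq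
      have e' : rep (⟨_, of_mem_subgraphProduct hu x⟩ * k) = k := by
        rw [e, hr.mul_right _ _ (Subgroup.mem_subgroupOf.2 (of_mem_subgraphProduct hS x)), hk]
      rcases ih ht with h' | h'
      · left
        rw [carryMul, alternatingProd_cons, alternatingProd_cons]
        simp only [e']
        rw [e, inv_mul_cancel_left, h', ← mul_assoc, ← mul_assoc, (h.mul_right hy).eq]
      · right
        rw [alternatingProd_cons]
        exact (h.mul_right hy).mul_right h'

/-- Alternating lists over a transversal of `G_L` in `G_S`, where `L` is the set of neighbours of
`v` in `S`, spell a transversal of `G_S` in `G_{S ∪ {v}}`. -/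
theorem IsCommutingTransversal.exists_insert {L S : Set V} {v : V} (hv : v ∉ S)
    (hL : ∀ w, w ∈ L ↔ w ∈ S ∧ Γ.Adj v w) {K : Set (GraphProduct Γ G)}
    (hK : IsCommutingTransversal Γ L S K) :
    ∃ K' : Set (GraphProduct Γ G), IsCommutingTransversal Γ S (insert v S) K' := by
  classical
  obtain ⟨rep, hr, hrep⟩ := hK.exists_isCosetRep
  let B := (GraphProduct.of Γ G v).range
  -- Vertices outside `insert v S` act trivially, so the action is defined on the whole graph
  -- product and not only on the subgroup in question.
  let f : ∀ w, G w →* Equiv.Perm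
      {w : List (subgraphProduct Γ G S × B) // IsAlternating rep w} := fun w =>
    if h : w = v then (consPerm hr).comp
      ((GraphProduct.of Γ G w).codRestrict B (by subst h; exact fun g => ⟨g, rfl⟩))
    else if h : w ∈ S then (carryPerm B hr).comp
      ((GraphProduct.of Γ G w).codRestrict _ (of_mem_subgraphProduct h))
    else 1
  have fv : ∀ g, f v g = consPerm hr ⟨GraphProduct.of Γ G v g, g, rfl⟩ := by
    intro g
    simp only [f, dif_pos]
    rfl
  have fS : ∀ w (h : w ∈ S) g, f w g = carryPerm B hr
      ⟨GraphProduct.of Γ G w g, of_mem_subgraphProduct h g⟩ := by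
    intro w h g
    have : w ≠ v := fun e => hv (e ▸ h)
    simp only [f, dif_neg this, dif_pos h]
    rfl
  have f1 : ∀ w, w ≠ v → w ∉ S → ∀ g, f w g = 1 := by
    intro w h h' g
    simp only [f, dif_neg h, dif_neg h', MonoidHom.one_apply]
  have fcomm : ∀ w, w ∈ S → Γ.Adj v w → ∀ g h, Commute (f w g) (f v h) := by
    intro w hw hvw g h
    rw [fv, fS w hw]
    exact commute_carryPerm_consPerm hr
      (Subgroup.mem_subgroupOf.2 (of_mem_subgraphProduct ((hL w).2 ⟨hw, hvw⟩) g)) _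
  obtain ⟨φ, hφ⟩ := GraphProduct.exists_lift Γ G f (by
    intro w w' hww g g'
    by_cases h : w = v
    · subst h
      by_cases h' : w' ∈ S
      · exact (fcomm w' h' hww _ _).symm
      · rw [f1 w' hww.ne' h']
        exact Commute.one_right _
    · by_cases hS : w ∈ S
      · by_cases h' : w' = v
        · subst h'
          exact fcomm w hS hww.symm _ _
        · by_cases hS' : w' ∈ S
          · rw [fS w hS, fS w' hS']
            refine Commute.map ?_ (carryPerm B hr)
            exact Subtype.ext (GraphProduct.commute_of Γ hww g g').eq
          · rw [f1 w' h' hS']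
            exact Commute.one_right _
      · rw [f1 w h hS]
        exact Commute.one_left _)
  have φS : ∀ a : subgraphProduct Γ G S, φ a = carryPerm B hr a := by
    rintro ⟨a, ha⟩
    refine subgraphProduct_induction (p := fun a => ∀ ha : a ∈ subgraphProduct Γ G S,
      φ a = carryPerm B hr ⟨a, ha⟩) (fun h => ?_) (fun w hw g a ha ih h => ?_) ha ha
    · rw [map_one]
      exact (map_one (carryPerm B hr)).symm
    · rw [map_mul, hφ, fS w hw, ih ha, ← map_mul]
      rfl
  have φB : ∀ b : B, φ b = consPerm hr b := by
    rintro ⟨_, g, rfl⟩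
    rw [hφ, fv]
  have φprod : ∀ (w : List (subgraphProduct Γ G S × B)) (hw : IsAlternating rep w),
      φ (alternatingProd w) ⟨[], trivial⟩ = ⟨w, hw⟩ := by
    intro w hw
    induction w with
    | nil => simp [alternatingProd_nil]
    | cons p t ih =>
      obtain ⟨h1, h2, h3, h4⟩ := hw
      rw [alternatingProd_cons, map_mul, map_mul, φS, φB, Equiv.Perm.mul_apply,
        Equiv.Perm.mul_apply, ih h3]
      apply Subtype.ext
      rw [carryPerm_apply, consPerm_apply, consMul_of_head h2 h4]
      simp [carryMul, h1, carryMul_one t h3]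
  refine ⟨alternatingProd '' {w : List (subgraphProduct Γ G S × B) | IsAlternating rep w},
    ⟨?_, ⟨[], trivial, rfl⟩, ?_, ?_⟩⟩
  · rintro _ ⟨w, -, rfl⟩
    refine list_prod_mem fun x hx => ?_
    obtain ⟨⟨k, _, g, rfl⟩, -, rfl⟩ := List.mem_map.1 hx
    exact mul_mem (subgraphProduct_mono (Set.subset_insert v S) k.2)
      (of_mem_subgraphProduct (Set.mem_insert v S) g)
  · rintro _ ⟨w, hw, rfl⟩ _ ⟨w', hw', rfl⟩ l hl h
    have h' := congrArg (fun a => φ a ⟨[], trivial⟩) h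
    -- The empty list stands for the trivial coset: `carryMul` discards what is left over at the end
    -- of a list, so G_S fixes it.
    have hl' : φ l ⟨[], trivial⟩ = ⟨[], trivial⟩ := by
      rw [φS ⟨l, hl⟩]
      rfl
    simp only [map_mul, Equiv.Perm.mul_apply, hl', φprod w hw, φprod w' hw',
      Subtype.mk.injEq] at h'
    rw [h']
  · rintro _ ⟨w, hw, rfl⟩ u hu x
    rcases hu with rfl | hu
    · left
      exact ⟨consMul ⟨_, x, rfl⟩ w, hw.consMul hr _, alternatingProd_consMul _ hw⟩
    · rcases alternatingProd_carryMul (fun w h => ((hL w).1 h).2) hK hr hrep hu x hw with h | h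
      · exact Or.inl ⟨_, hw.carryMul hr _, h⟩
      · exact Or.inr ⟨hu, h⟩

/-- The induction hypothesis for T ∖ {v} is used twice: with S, and with the neighbours of v, which
supply the representatives needed to adjoin v. The two resulting transversals are then multiplied.
-/
theorem exists_isCommutingTransversal [Finite V] (S T : Set V) (hST : S ⊆ T) :
    ∃ K : Set (GraphProduct Γ G), IsCommutingTransversal Γ S T K := by
  induction hn : T.ncard using Nat.strong_induction_on generalizing S T with
  | _ n ih =>
    by_cases hTS : T ⊆ S
    · obtain rfl := hST.antisymm hTS
      exact ⟨_, IsCommutingTransversal.refl S⟩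
    · obtain ⟨v, hvT, hvS⟩ := Set.not_subset.1 hTS
      have hlt : (T \ {v}).ncard < n := hn ▸ Set.ncard_sdiff_singleton_lt_of_mem hvT
      have hS : S ⊆ T \ {v} := Set.subset_sdiff_singleton hST hvS
      obtain ⟨K, hK⟩ := ih _ hlt S (T \ {v}) hS rfl
      obtain ⟨M, hM⟩ := ih _ hlt {w | w ∈ T \ {v} ∧ Γ.Adj v w} (T \ {v}) (fun _ h => h.1) rfl
      obtain ⟨M', hM'⟩ := hM.exists_insert (v := v) (by simp) (fun _ => Iff.rfl)
      rw [Set.insert_sdiff_singleton, Set.insert_eq_of_mem hvT] at hM'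
      exact ⟨_, hK.trans hS Set.sdiff_subset hM'⟩

end SubgraphTransversals

/-! ### Additivity of word length and shortlex normal forms -/

section WordLength

variable {G : Type*} [Group G]

theorem wordEval_cons {X : Set G} (a : X) (w : List X) : wordEval (a :: w) = a * wordEval w := by
  simp [wordEval]

theorem wordEval_append {X : Set G} (w w' : List X) :
    wordEval (w ++ w') = wordEval w * wordEval w' := by
  simp [wordEval]

theorem wordEval_map_inclusion {X Y : Set G} (h : Y ⊆ X) (w : List Y) :
    wordEval (w.map (Set.inclusion h)) = wordEval w := by
  simp [wordEval, Function.comp_def]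

theorem IsInvClosedGenSet.exists_wordEval_eq {X : Set G} {H : Subgroup G}
    (hX : IsInvClosedGenSet X H) {g : G} (hg : g ∈ H) : ∃ w : List X, wordEval w = g := by
  rw [← hX.closure_eq] at hg
  induction hg using Subgroup.closure_induction_left with
  | one => exact ⟨[], rfl⟩
  | mul_left x hx y _ ih =>
    obtain ⟨w, rfl⟩ := ih
    exact ⟨⟨x, hx⟩ :: w, wordEval_cons _ _⟩
  | inv_mul_cancel x hx y _ ih =>
    obtain ⟨w, rfl⟩ := ih
    exact ⟨⟨x⁻¹, hX.inv_mem x hx⟩ :: w, wordEval_cons _ _⟩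

theorem eltLength_le {X : Set G} {g : G} {w : List X} (h : wordEval w = g) :
    eltLength X g ≤ w.length :=
  Nat.sInf_le ⟨w, h, rfl⟩

theorem IsInvClosedGenSet.exists_geodesic {X : Set G} {H : Subgroup G}
    (hX : IsInvClosedGenSet X H) {g : G} (hg : g ∈ H) :
    ∃ w : List X, wordEval w = g ∧ w.length = eltLength X g := by
  obtain ⟨w, hw⟩ := hX.exists_wordEval_eq hg
  exact Nat.sInf_mem (s := {n : ℕ | ∃ w : List X, wordEval w = g ∧ w.length = n}) ⟨_, w, hw, rfl⟩

/-- If right multiplication by a letter keeps an element of `U` in `U` or commutes with it, the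
letter then being in `Y`, then lengths add up in products `h * u`. -/
theorem eltLength_mul_of_mem_or {X Y U : Set G} {H : Subgroup G} (hX : IsInvClosedGenSet X ⊤)
    (hY : IsInvClosedGenSet Y H) (hYX : Y ⊆ X) (hU : Subgroup.IsComplement (H : Set G) U)
    (h1 : (1 : G) ∈ U) (hmul : ∀ u ∈ U, ∀ x ∈ X, u * x ∈ U ∨ x ∈ Y ∧ Commute x u)
    {h u : G} (hh : h ∈ H) (hu : u ∈ U) : eltLength X (h * u) = eltLength Y h + eltLength X u := by
  apply le_antisymm
  · obtain ⟨w, hw, hwl⟩ := hY.exists_geodesic hh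
    obtain ⟨w', hw', hwl'⟩ := hX.exists_geodesic (Subgroup.mem_top u)
    rw [← hwl, ← hwl', ← List.length_map (as := w) (Set.inclusion hYX), ← List.length_append]
    apply eltLength_le
    rw [wordEval_append, wordEval_map_inclusion, hw, hw']
  -- Each letter is sent either to the `U`-word or, having slid past it, to the end of the `Y`-word,
  -- so the total length is preserved.
  · have key : ∀ w : List X, ∃ (v : List Y) (w' : List X), wordEval w' ∈ U ∧
        wordEval w = wordEval v * wordEval w' ∧ v.length + w'.length = w.length := by
      intro w
      induction w using List.reverseRecOn with
      | nil => exact ⟨[], [], h1, by simp [wordEval], rfl⟩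
      | append_singleton w x ih =>
        obtain ⟨v, w', hw'U, hw, hl⟩ := ih
        have hx : wordEval [x] = (x : G) := by simp [wordEval]
        rcases hmul _ hw'U x x.2 with hxU | ⟨hxY, hc⟩
        · refine ⟨v, w' ++ [x], ?_, ?_, ?_⟩
          · rwa [wordEval_append, hx]
          · rw [wordEval_append, wordEval_append, hw, mul_assoc]
          · simp [← hl, add_assoc]
        · refine ⟨v ++ [⟨x, hxY⟩], w', hw'U, ?_, ?_⟩
          · have hx' : wordEval [(⟨x, hxY⟩ : Y)] = (x : G) := by simp [wordEval]
            rw [wordEval_append, wordEval_append, hw, hx, hx', mul_assoc, mul_assoc, hc.eq]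
          · simp [← hl]; omega
    obtain ⟨w, hw, hwl⟩ := hX.exists_geodesic (Subgroup.mem_top (h * u))
    obtain ⟨v, w', hw'U, hvw, hl⟩ := key w
    have hvH : wordEval v ∈ H := by
      rw [← hY.closure_eq]
      refine list_prod_mem fun y hy => ?_
      obtain ⟨y, -, rfl⟩ := List.mem_map.1 hy
      exact Subgroup.subset_closure y.2
    -- Uniqueness in the transversal shows that the two words produced from a geodesic spell h and u
    -- themselves.
    have e := hU.1 (a₁ := (⟨h, hh⟩, ⟨u, hu⟩)) (a₂ := (⟨_, hvH⟩, ⟨_, hw'U⟩)) (hw.symm.trans hvw)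
    simp only [Prod.mk.injEq, Subtype.mk.injEq] at e
    rw [← hwl, ← hl]
    exact add_le_add (eltLength_le e.1.symm) (eltLength_le e.2.symm)

theorem IsShortlexNormalForm.unique {X : Set G} {r : X → X → Prop} [Std.Asymm r] {g : G}
    {w w' : List X} (h : IsShortlexNormalForm r g w) (h' : IsShortlexNormalForm r g w') :
    w = w' := by
  rcases h.2 w' h'.1 with e | e
  · exact e
  · rcases h'.2 w h.1 with e' | e'
    · exact e'.symm
    · exact (asymm e e').elim

theorem IsShortlexNormalForm.length_eq {X : Set G} {H : Subgroup G} (hX : IsInvClosedGenSet X H)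
    {r : X → X → Prop} {g : G} (hg : g ∈ H) {w : List X} (h : IsShortlexNormalForm r g w) :
    w.length = eltLength X g := by
  apply le_antisymm _ (eltLength_le h.1)
  obtain ⟨w', hw', hl⟩ := hX.exists_geodesic hg
  rw [← hl]
  rcases h.2 w' hw' with rfl | e
  · exact le_rfl
  · rcases List.shortlex_def.1 e with e | e
    · exact e.le
    · exact e.1.le

theorem isShortlexNormalForm_nil {X : Set G} (r : X → X → Prop) :
    IsShortlexNormalForm r (1 : G) ([] : List X) :=
  ⟨rfl, fun w' _ => (List.shortlex_nil_or_eq_nil w').symm.imp_left Eq.symm⟩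

theorem exists_isShortlexNormalForm {X : Set G} {H : Subgroup G} (hX : IsInvClosedGenSet X H)
    (r : X → X → Prop) [IsWellOrder X r] {g : G} (hg : g ∈ H) :
    ∃ w : List X, IsShortlexNormalForm r g w := by
  have hwf : WellFounded (List.Shortlex r) := List.Shortlex.wf IsWellFounded.wf
  have hne : {w : List X | wordEval w = g}.Nonempty := hX.exists_wordEval_eq hg
  refine ⟨hwf.min _ hne, hwf.min_mem _ hne, fun w' hw' => ?_⟩
  by_contra! hcon
  exact hcon.1 (Std.Trichotomous.trichotomous (r := List.Shortlex r) _ _ hcon.2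
    (hwf.not_lt_min _ hw'))

/-- If every letter of `Y` precedes all the other letters, the shortlex normal forms that are empty
or start outside `Y` represent the admissible right transversal. -/
theorem IsAdmissibleRightTransversal.bijOn_wordEval {H : Subgroup G} {X Y U : Set G}
    (hU : IsAdmissibleRightTransversal H X Y U) (r : X → X → Prop) [IsWellOrder X r]
    {Z : Set X} (hZ : ∀ a : X, (a : G) ∈ Y ∨ a ∈ Z)
    (hYZ : ∀ a b : X, (a : G) ∈ Y → b ∈ Z → r a b) :
    Set.BijOn wordEval
      ({[]} ∪ (shortlexLanguage r ∩ {w | ∃ (a : X) (t : List X), a ∈ Z ∧ w = a :: t})) U := by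
  have hlang : ∀ w ∈ ({[]} ∪ (shortlexLanguage r ∩
      {w | ∃ (a : X) (t : List X), a ∈ Z ∧ w = a :: t}) : Set (List X)),
      IsShortlexNormalForm r (wordEval w) w := by
    rintro w (rfl | ⟨⟨g, hg⟩, -⟩)
    · exact isShortlexNormalForm_nil r
    · rwa [hg.1]
  have hsplit : ∀ g : G, ∃ h ∈ H, ∃ u ∈ U, h * u = g := by
    intro g
    obtain ⟨⟨h, u⟩, e⟩ := hU.transversal.2 g
    exact ⟨h, h.2, u, u.2, e⟩
  refine ⟨fun w hw => ?_, fun w hw w' hw' e => (hlang w hw).unique (e ▸ hlang w' hw'),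
    fun u hu => ?_⟩
  · have hnf := hlang w hw
    rcases hw with rfl | ⟨-, a, t, ha, rfl⟩
    · exact hU.one_mem
    · obtain ⟨h, hh, u, hu, e⟩ := hsplit (wordEval (a :: t))
      obtain ⟨v, hv, hvl⟩ := hU.gen_sub.exists_geodesic hh
      obtain ⟨w', hw', hwl'⟩ := hU.gen_top.exists_geodesic (Subgroup.mem_top u)
      cases v with
      | nil =>
        obtain rfl : 1 = h := hv
        rwa [← e, one_mul]
      -- Joining geodesics for h ≠ 1 and u would give a word of the same length as the normal form,
      -- but starting with y ∈ Y, which precedes a.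
      | cons y v =>
        exfalso
        have hl := hnf.length_eq hU.gen_top (Subgroup.mem_top _)
        rw [← e, hU.length_mul h hh u hu, ← hvl, ← hwl'] at hl
        have hr := hYZ ⟨y, hU.subset y.2⟩ a y.2 ha
        rcases hnf.2 ((y :: v).map (Set.inclusion hU.subset) ++ w') (by
          rw [wordEval_append, wordEval_map_inclusion, hv, hw', e]) with e' | e'
        · simp only [List.map_cons, List.cons_append, List.cons.injEq] at e'
          rw [e'.1] at hr
          exact irrefl_of r _ hr
        · rw [List.shortlex_iff_lex (by simp at hl ⊢; omega)] at e'
          simp only [List.map_cons, List.cons_append] at e'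
          cases e' with
          | rel h' => exact asymm h' hr
          | cons h' => exact irrefl_of r _ hr
  · obtain ⟨w, hw⟩ := exists_isShortlexNormalForm hU.gen_top r (Subgroup.mem_top u)
    refine ⟨w, ?_, hw.1⟩
    cases w with
    | nil => exact Or.inl rfl
    | cons a t =>
      refine Or.inr ⟨⟨u, hw⟩, a, t, (hZ a).resolve_left fun ha => ?_, rfl⟩
      obtain ⟨h, hh, u', hu', e⟩ := hsplit (wordEval t)
      have haH : (a : G) ∈ H := hU.gen_sub.closure_eq ▸ Subgroup.subset_closure ha
      have e1 : u = a * h * u' := by rw [← hw.1, wordEval_cons, ← e, mul_assoc]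
      -- Comparing 1·u with (ah)·u' gives u' = u. Then |u| ≤ |h| + |u| = |hu| ≤ |t|, although the
      -- normal form a :: t of u has length |u| = |t| + 1.
      have e2 := hU.transversal.1 (a₁ := (⟨1, H.one_mem⟩, ⟨u, hu⟩))
        (a₂ := (⟨_, mul_mem haH hh⟩, ⟨u', hu'⟩)) (by simpa using e1)
      simp only [Prod.mk.injEq, Subtype.mk.injEq] at e2
      have hl := hw.length_eq hU.gen_top (Subgroup.mem_top _)
      have hl' := hU.length_mul h hh u' hu'
      have hl'' := eltLength_le (X := X) (w := t) e.symm
      rw [e2.2] at hl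
      simp only [List.length_cons] at hl
      omega

end WordLength

/-! ### Admissible transversals in graph products -/

section GraphProductTransversal

variable {V : Type*} {Γ : SimpleGraph V} {G : V → Type*} [∀ v, Group (G v)]

theorem isInvClosedGenSet_graphProductGens {X : ∀ v, Set (G v)}
    (hX : ∀ v, IsInvClosedGenSet (X v) ⊤) (S : Set V) :
    IsInvClosedGenSet (graphProductGens Γ X S) (subgraphProduct Γ G S) where
  inv_mem := by
    intro x hx
    simp only [graphProductGens, Set.mem_iUnion] at hx ⊢
    obtain ⟨v, hv, g, hg, rfl⟩ := hx
    exact ⟨v, hv, g⁻¹, (hX v).inv_mem g hg, map_inv _ _⟩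
  closure_eq := by
    simp only [graphProductGens, subgraphProduct, Subgroup.closure_iUnion]
    refine iSup_congr fun v => iSup_congr fun _ => ?_
    rw [← MonoidHom.map_closure, (hX v).closure_eq, ← MonoidHom.range_eq_map,
      ← MonoidHom.coe_range, Subgroup.closure_eq]

theorem subgraphProduct_univ : subgraphProduct Γ G Set.univ = ⊤ := by
  rw [eq_top_iff]
  rintro g -
  obtain ⟨g, rfl⟩ := QuotientGroup.mk_surjective g
  induction g using Monoid.CoprodI.induction_on with
  | one => exact one_mem _
  | of v g => exact of_mem_subgraphProduct (Set.mem_univ v) g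
  | mul a b ha hb => exact mul_mem ha hb

theorem exists_isAdmissibleRightTransversal [Finite V] (X : ∀ v, Set (G v))
    (hX : ∀ v, IsInvClosedGenSet (X v) ⊤) (S : Set V) :
    ∃ U : Set (GraphProduct Γ G), IsAdmissibleRightTransversal (subgraphProduct Γ G S)
      (graphProductGens Γ X Set.univ) (graphProductGens Γ X S) U := by
  obtain ⟨K, hK⟩ := exists_isCommutingTransversal (Γ := Γ) (G := G) S Set.univ (Set.subset_univ S)
  have htop : IsInvClosedGenSet (graphProductGens Γ X Set.univ) ⊤ :=
    subgraphProduct_univ (Γ := Γ) (G := G) ▸ isInvClosedGenSet_graphProductGens hX Set.univ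
  have hsub := isInvClosedGenSet_graphProductGens (Γ := Γ) hX S
  have hYX : graphProductGens Γ X S ⊆ graphProductGens Γ X Set.univ :=
    Set.biUnion_subset_biUnion_left (Set.subset_univ S)
  -- Inversion turns left cosets and left multiplication into right ones.
  have h1 : (1 : GraphProduct Γ G) ∈ {u | u⁻¹ ∈ K} := by simpa using hK.one_mem
  have hcompl : Subgroup.IsComplement (subgraphProduct Γ G S : Set (GraphProduct Γ G))
      {u | u⁻¹ ∈ K} := by
    constructor
    · rintro ⟨⟨h, hh⟩, u, hu⟩ ⟨⟨h', hh'⟩, u', hu'⟩ e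
      simp only at e
      have : u⁻¹ = u'⁻¹ := by
        refine hK.eq_of_eq_mul _ hu _ hu' (h'⁻¹ * h) (mul_mem (inv_mem hh') hh) ?_
        rw [← mul_assoc, ← mul_inv_rev, ← e, mul_inv_rev, inv_mul_cancel_right]
      obtain rfl := inv_injective this
      obtain rfl := mul_right_cancel e
      rfl
    · intro g
      obtain ⟨k, hk, l, hl, e⟩ := hK.exists_eq_mul
        (g := g⁻¹) (subgraphProduct_univ (Γ := Γ) (G := G) ▸ Subgroup.mem_top _)
      refine ⟨(⟨l⁻¹, inv_mem hl⟩, ⟨k⁻¹, by simpa using hk⟩), ?_⟩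
      simp only [← mul_inv_rev, ← e, inv_inv]
  refine ⟨_, htop, hsub, hYX, hcompl, h1, fun h hh u hu =>
    eltLength_mul_of_mem_or htop hsub hYX hcompl h1 ?_ hh hu⟩
  intro u hu x hx
  simp only [graphProductGens, Set.mem_iUnion] at hx ⊢
  obtain ⟨v, hv, g, hg, rfl⟩ := hx
  rcases hK.mul_mem_or _ hu v hv g⁻¹ with h | ⟨hS, h⟩
  · left
    simpa using h
  · rw [map_inv] at h
    exact Or.inr ⟨⟨v, hS, g, hg, rfl⟩, Commute.inv_inv_iff.1 h⟩

end GraphProductTransversal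

theorem lemma3p9 {V : Type*} [Finite V] (Γ : SimpleGraph V)
    {G : V → Type*} [∀ v, Group (G v)]
    (X : ∀ v, Set (G v)) (hX : ∀ v, IsInvClosedGenSet (X v) ⊤)
    (V' : Set V)
    (ll : V → V → Prop) (hll : IsStrictTotalOrder V ll)
    (hV' : ∀ a ∈ V', ∀ b ∉ V', ll a b)
    (r : graphProductGens Γ X Set.univ → graphProductGens Γ X Set.univ → Prop)
    (hr : IsWellOrder (graphProductGens Γ X Set.univ) r)
    (hcomp : IsCompatibleOrder Γ X ll r) :
    ∃ U : Set (GraphProduct Γ G),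
      IsAdmissibleRightTransversal (subgraphProduct Γ G V')
        (graphProductGens Γ X Set.univ) (graphProductGens Γ X V') U ∧
      Set.BijOn wordEval (transversalLanguage Γ X V' r) U := by
  obtain ⟨U, hU⟩ := exists_isAdmissibleRightTransversal (Γ := Γ) X hX V'
  refine ⟨U, hU, hU.bijOn_wordEval r
    (Z := {a | (a : GraphProduct Γ G) ∈ graphProductGens Γ X V'ᶜ}) ?_ ?_⟩
  · rintro ⟨a, ha⟩
    simp only [graphProductGens, Set.mem_iUnion] at ha ⊢
    obtain ⟨v, -, ha⟩ := ha
    by_cases hv : v ∈ V'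
    · exact Or.inl ⟨v, hv, ha⟩
    · exact Or.inr ⟨v, hv, ha⟩
  · rintro ⟨a, ha⟩ ⟨b, hb⟩ haV hbV
    simp only [graphProductGens, Set.mem_iUnion] at haV hbV
    obtain ⟨v, hv, x, hx, rfl⟩ := haV
    obtain ⟨w, hw, y, hy, rfl⟩ := hbV
    obtain ⟨s, -, hs⟩ := hcomp
    exact (hs v w ⟨x, hx⟩ ⟨y, hy⟩).2 (Sigma.Lex.left _ _ (hV' v hv w hw))
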